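/- Let $d\ge 0$ and let $\mathbf{S}_1,\mathbf{S}_2,\ldots,\mathbf{S}_{d+1}$ be nonempty finite sets of points in $\mathbb{R}^d$ (no general position is assumed). For a point $x\in\mathbb{R}^d$ let $\overrightarrow{x\mathbf{0}}=\{x+t(\mathbf{0}-x): t\ge 0\}$ denote the ray originating from $x$ towards the origin $\mathbf{0}$. Assume that, for each $1\le i<j\le d+1$, there exists $k\in\{1,\ldots,d+1\}\setminus\{i,j\}$ such that, for all $x_k\in\mathbf{S}_k$, the convex hull of $\mathbf{S}_i\cup\mathbf{S}_j$ intersects the ray $\overrightarrow{x_k\mathbf{0}}$ in a point distinct from $x_k$. Then there exist points $x_i\in\mathbf{S}_i$, one for each $i=1,\ldots,d+1$, such that $\mathbf{0}\in\operatorname{conv}\{x_1,\ldots,x_{d+1}\}$. In particular, if the sets $\mathbf{S}_i$ are pairwise disjoint, then $S=\{x_1,\ldots,x_{d+1}\}\subseteq\bigcup_i\mathbf{S}_i$ satisfies $|S\cap\mathbf{S}_i|=1$ for $i=1,\ldots,d+1$ and $\mathbf{0}\in\operatorname{conv}(S)$. -/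

import Mathlib

/-- The ray originating from the point `x` towards the origin `0` of `ℝ^d`; it contains `x` and
continues beyond `0`. (For `x = 0` there is no direction, and it is the single point `0`.) -/
def rayToOrigin {d : ℕ} (x : EuclideanSpace ℝ (Fin d)) : Set (EuclideanSpace ℝ (Fin d)) :=
  {y | ∃ t : ℝ, 0 ≤ t ∧ y = x + t • (0 - x)}

/-! Let `p` be a point of least norm in the union of the hulls of all transversals, and suppose `p ≠
0`. By Carathéodory, `p` is a positive combination of linearly independent `x j` on the hyperplane
`⟪p, ·⟫ = ‖p‖ ^ 2`, so some colour is missing; shielding forces exactly one missing colour `i`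
(`eq_of_weight_eq_zero`). All of `S i` lies on the far side of the hyperplane, so shielding applied
to `i` and `j` gives a `y j ∈ S j` strictly on the near side.

Choosing `x j` or `y j` for each `j ≠ i` yields `2 ^ d` simplicial cones. By minimality `p` lies
only in the cone of the `x j`. A degree argument modulo 2 (`exists_choice_mem_stdSimplex_relation`)
then shows that, unless one of the cones already carries a nontrivial nonnegative relation, the
cones cover the space. If a generic `q` were in no cone, the ray from `q` in direction `p` would
cross one facet of the cone of the `x j` and an even number of facets of every other cone, yet each
facet is shared by two cones. Covering `-z` for `z ∈ S i` puts the origin in the hull of a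
transversal. -/

/-- The polyhedron of nonnegative solutions `a` of `∑ l, a l • e l = q` meets the hyperplane
`a i = 0`. -/
def HasSolutionVanishingAt {V κ : Type*} [AddCommGroup V] [Module ℝ V] [Fintype κ]
    (e : κ → V) (q : V) (i : κ) : Prop :=
  ∃ a : κ → ℝ, (∀ l, 0 ≤ a l) ∧ a i = 0 ∧ ∑ l, a l • e l = q

/-- `q` lies in no proper subspace spanned by some of the vectors `e l`. -/
def IsGenericFor {V κ : Type*} [AddCommGroup V] [Module ℝ V] (e : κ → V) (q : V) : Prop :=
  ∀ B : Set κ, q ∈ Submodule.span ℝ (e '' B) → Submodule.span ℝ (e '' B) = ⊤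

/-! ### Parity of the endpoints of a one-dimensional polyhedron. -/

section Generic

variable {V κ : Type*} [AddCommGroup V] [Module ℝ V] [Fintype κ] {e : κ → V} {q : V}

theorem sum_smul_mem_span_of_eq_zero_off {a : κ → ℝ} {B : Set κ} (h : ∀ l, l ∉ B → a l = 0) :
    ∑ l, a l • e l ∈ Submodule.span ℝ (e '' B) := by
  refine Submodule.sum_mem _ fun l _ => ?_
  by_cases hl : l ∈ B
  · exact Submodule.smul_mem _ _ (Submodule.subset_span ⟨l, hl, rfl⟩)
  · simp [h l hl]

/-- With two vanishing coordinates, `q` would be spanned by fewer vectors than the dimension. -/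
theorem IsGenericFor.ne_zero_of_eq_zero [FiniteDimensional ℝ V] (hq : IsGenericFor e q)
    (hcard : Fintype.card κ = Module.finrank ℝ V + 1) {a : κ → ℝ} (ha : ∑ l, a l • e l = q)
    {i l : κ} (hi : a i = 0) (hil : l ≠ i) : a l ≠ 0 := by
  classical
  intro hl
  let B : Finset κ := (Finset.univ.erase i).erase l
  have hB : B.card + 1 = Module.finrank ℝ V := by
    have h1 : ((Finset.univ : Finset κ).erase i).card + 1 = Fintype.card κ :=
      Finset.card_erase_add_one (Finset.mem_univ i)
    have h2 : B.card + 1 = ((Finset.univ : Finset κ).erase i).card :=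
      Finset.card_erase_add_one (by simp [hil])
    omega
  have hmem : q ∈ Submodule.span ℝ (e '' (B : Set κ)) := by
    rw [← ha]
    refine sum_smul_mem_span_of_eq_zero_off fun m hm => ?_
    by_cases h1 : m = l
    · rw [h1, hl]
    · by_cases h2 : m = i
      · rw [h2, hi]
      · exact absurd (by simp [B, h1, h2]) hm
  have htop := hq _ hmem
  have hle : Module.finrank ℝ (Submodule.span ℝ (e '' (B : Set κ))) ≤ B.card := by
    rw [← Finset.coe_image]
    exact (finrank_span_finset_le_card _).trans Finset.card_image_le
  rw [htop, finrank_top] at hle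
  omega

theorem IsGenericFor.relation_eq_zero [FiniteDimensional ℝ V] (hq : IsGenericFor e q)
    (hcard : Fintype.card κ = Module.finrank ℝ V + 1) {a c : κ → ℝ} (ha : ∑ l, a l • e l = q)
    {i : κ} (hi : a i = 0) (hc : ∑ l, c l • e l = 0) (hci : c i = 0) : c = 0 := by
  classical
  have hmem : q ∈ Submodule.span ℝ (e '' {l | l ≠ i}) := by
    rw [← ha]
    refine sum_smul_mem_span_of_eq_zero_off fun m hm => ?_
    have : m = i := by simpa using hm
    rw [this, hi]
  have htop := hq _ hmem
  have hli : LinearIndependent ℝ (fun l : {l // l ≠ i} => e l) := by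
    apply linearIndependent_of_top_le_span_of_card_eq_finrank
    · rw [← htop]
      apply Submodule.span_mono
      rintro _ ⟨l, hl, rfl⟩
      exact ⟨⟨l, hl⟩, rfl⟩
    · rw [Fintype.card_subtype_compl, Fintype.card_subtype_eq, hcard]
      rfl
  rw [Fintype.linearIndependent_iff] at hli
  have hsum : ∑ l : {l // l ≠ i}, c l • e l = 0 := by
    rw [← hc, ← Finset.sum_subtype (Finset.univ.erase i) (by simp) (fun l => c l • e l)]
    rw [← Finset.add_sum_erase Finset.univ _ (Finset.mem_univ i), hci, zero_smul, zero_add]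
  funext l
  by_cases hl : l = i
  · rw [hl, hci]; rfl
  · exact hli (fun l => c l) hsum ⟨l, hl⟩

theorem IsGenericFor.exists_eq_add_smul [FiniteDimensional ℝ V] (hq : IsGenericFor e q)
    (hcard : Fintype.card κ = Module.finrank ℝ V + 1) {a a' c : κ → ℝ}
    (ha : ∑ l, a l • e l = q) {i : κ} (hi : a i = 0) (ha' : ∑ l, a' l • e l = q)
    (hc : ∑ l, c l • e l = 0) (hci : c i ≠ 0) : ∃ s : ℝ, ∀ l, a' l = a l + s * c l := by
  refine ⟨a' i / c i, fun l => ?_⟩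
  have h := hq.relation_eq_zero hcard ha hi (c := fun l => a' l - a l - a' i / c i * c l)
    (by simp [sub_smul, Finset.sum_sub_distrib, mul_smul, ← Finset.smul_sum, ha, ha', hc])
    (by simp [hi, hci])
  have := congrFun h l
  simp only [Pi.zero_apply] at this
  linarith

/-- All solutions lie on a line of direction `c`. A coordinate increasing along `c` can only vanish
at the lower endpoint, where genericity allows a single zero. -/
theorem IsGenericFor.eq_of_hasSolutionVanishingAt_of_pos [FiniteDimensional ℝ V]
    (hq : IsGenericFor e q) (hcard : Fintype.card κ = Module.finrank ℝ V + 1) {c : κ → ℝ}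
    (hc : ∑ l, c l • e l = 0) {i i' : κ} (h : HasSolutionVanishingAt e q i)
    (h' : HasSolutionVanishingAt e q i') (hi : 0 < c i) (hi' : 0 < c i') : i = i' := by
  obtain ⟨a, ha0, hai, ha⟩ := h
  obtain ⟨a', ha0', hai', ha'⟩ := h'
  obtain ⟨s, hs⟩ := hq.exists_eq_add_smul hcard ha hai ha' hc hi.ne'
  have h1 : 0 ≤ s := by
    have := ha0' i
    rw [hs, hai, zero_add] at this
    exact nonneg_of_mul_nonneg_left this hi
  have h2 : a i' = 0 := by
    refine le_antisymm ?_ (ha0 i')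
    have := hs i'
    nlinarith [mul_nonneg h1 hi'.le]
  by_contra hne
  exact hq.ne_zero_of_eq_zero hcard ha hai (Ne.symm hne) h2

/-- Ratio test: move along `c` until a decreasing coordinate first reaches zero. -/
theorem exists_hasSolutionVanishingAt_of_neg {a c : κ → ℝ} (ha0 : ∀ l, 0 ≤ a l)
    (ha : ∑ l, a l • e l = q) (hc : ∑ l, c l • e l = 0) {i : κ} (hi : c i < 0) :
    ∃ l, c l < 0 ∧ HasSolutionVanishingAt e q l := by
  classical
  obtain ⟨l, hl, hmin⟩ := Finset.exists_min_image (Finset.univ.filter fun l => c l < 0)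
    (fun l => a l / (-c l)) ⟨i, by simpa using hi⟩
  have hcl : c l < 0 := by simpa using hl
  refine ⟨l, hcl, fun m => a m + a l / (-c l) * c m, fun m => ?_, ?_, ?_⟩
  · have hs : 0 ≤ a l / (-c l) := div_nonneg (ha0 l) (by linarith)
    show 0 ≤ a m + a l / (-c l) * c m
    by_cases hm : c m < 0
    · have h1 := hmin m (by simpa using hm)
      rw [le_div_iff₀ (by linarith)] at h1
      linarith
    · have := mul_nonneg hs (not_lt.mp hm)
      linarith [ha0 m]
  · have : c l ≠ 0 := hcl.ne
    show a l + a l / (-c l) * c l = 0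
    field_simp
    ring
  · simp [add_smul, Finset.sum_add_distrib, mul_smul, ← Finset.smul_sum, ha, hc]

theorem sum_neg_smul_eq_zero {c : κ → ℝ} (hc : ∑ l, c l • e l = 0) :
    ∑ l, (-c) l • e l = 0 := by
  simp [hc]

-- Pointedness bounds the polyhedron in both directions, so it is empty or a segment with two
-- endpoints.
open Classical in
theorem IsGenericFor.even_card_hasSolutionVanishingAt [FiniteDimensional ℝ V]
    (hq : IsGenericFor e q) (hcard : Fintype.card κ = Module.finrank ℝ V + 1)
    (hpointed : ∀ c : κ → ℝ, (∀ l, 0 ≤ c l) → ∑ l, c l • e l = 0 → c = 0) :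
    Even (Finset.univ.filter fun i => HasSolutionVanishingAt e q i).card := by
  rcases (Finset.univ.filter fun i => HasSolutionVanishingAt e q i).eq_empty_or_nonempty with
    h | ⟨i, hi⟩
  · simp [h]
  replace hi : HasSolutionVanishingAt e q i := by simpa using hi
  obtain ⟨c, hc, hc0⟩ : ∃ c : κ → ℝ, ∑ l, c l • e l = 0 ∧ c ≠ 0 := by
    have hnot : ¬ LinearIndependent ℝ e := fun h => by
      have := h.fintype_card_le_finrank
      omega
    obtain ⟨c, hc, l, hl⟩ := Fintype.not_linearIndependent_iff.mp hnot
    exact ⟨c, hc, fun h => hl (congrFun h l)⟩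
  have hne : ∀ l, HasSolutionVanishingAt e q l → ∀ c : κ → ℝ, ∑ l, c l • e l = 0 → c ≠ 0 →
      c l ≠ 0 := by
    rintro l ⟨a, -, hal, ha⟩ c hc hc0 hcl
    exact hc0 (hq.relation_eq_zero hcard ha hal hc hcl)
  have key : ∀ c : κ → ℝ, ∑ l, c l • e l = 0 → c ≠ 0 → 0 < c i →
      Even (Finset.univ.filter fun i => HasSolutionVanishingAt e q i).card := by
    intro c hc hc0 hci
    obtain ⟨m, hm⟩ : ∃ m, c m < 0 := by
      by_contra! h
      exact hc0 (hpointed c h hc)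
    obtain ⟨a, ha0, hai, ha⟩ := hi
    obtain ⟨j, hj, hjv⟩ := exists_hasSolutionVanishingAt_of_neg ha0 ha hc hm
    have hij : i ≠ j := fun h => by rw [h] at hci; linarith
    have : (Finset.univ.filter fun i => HasSolutionVanishingAt e q i) = {i, j} := by
      ext l
      simp only [Finset.mem_filter, Finset.mem_univ, true_and, Finset.mem_insert,
        Finset.mem_singleton]
      constructor
      · intro hl
        rcases lt_or_gt_of_ne (hne l hl c hc hc0) with h | h
        · exact .inr (hq.eq_of_hasSolutionVanishingAt_of_pos hcard (sum_neg_smul_eq_zero hc)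
            hl hjv (by simpa using h) (by simpa using hj))
        · exact .inl (hq.eq_of_hasSolutionVanishingAt_of_pos hcard hc hl ⟨a, ha0, hai, ha⟩ h hci)
      · rintro (rfl | rfl)
        · exact ⟨a, ha0, hai, ha⟩
        · exact hjv
    rw [this, Finset.card_pair hij]
    exact even_two
  rcases lt_or_gt_of_ne (hne i hi c hc hc0) with h | h
  · exact key (-c) (sum_neg_smul_eq_zero hc) (neg_ne_zero.mpr hc0) (by simpa using h)
  · exact key c hc hc0 h

-- A positive relation makes the polyhedron a ray, with one endpoint.
open Classical in
theorem IsGenericFor.card_hasSolutionVanishingAt_eq_one [FiniteDimensional ℝ V]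
    (hq : IsGenericFor e q) (hcard : Fintype.card κ = Module.finrank ℝ V + 1) {a c : κ → ℝ}
    (ha : ∑ l, a l • e l = q) (hc : ∑ l, c l • e l = 0) (hc0 : ∀ l, 0 < c l) :
    (Finset.univ.filter fun i => HasSolutionVanishingAt e q i).card = 1 := by
  have hne : (Finset.univ : Finset κ).Nonempty := by
    rw [← Finset.card_pos, Finset.card_univ]
    omega
  obtain ⟨s, hs⟩ : ∃ s : ℝ, ∀ l, 0 ≤ a l + s * c l := by
    obtain ⟨m, -, hm⟩ := Finset.exists_max_image Finset.univ (fun l => -a l / c l) hne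
    refine ⟨-a m / c m, fun l => ?_⟩
    have := hm l (Finset.mem_univ l)
    rw [div_le_iff₀ (hc0 l)] at this
    linarith
  obtain ⟨i, -⟩ := hne
  obtain ⟨j, -, hj⟩ := exists_hasSolutionVanishingAt_of_neg (q := q) (i := i) hs
    (by simp [add_smul, Finset.sum_add_distrib, mul_smul, ← Finset.smul_sum, ha, hc])
    (sum_neg_smul_eq_zero hc) (by simpa using hc0 i)
  rw [Finset.card_eq_one]
  refine ⟨j, ?_⟩
  ext l
  simp only [Finset.mem_filter, Finset.mem_univ, true_and, Finset.mem_singleton]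
  exact ⟨fun hl => hq.eq_of_hasSolutionVanishingAt_of_pos hcard hc hl hj (hc0 l) (hc0 j),
    fun h => h ▸ hj⟩

end Generic

/-! ### Covering the space by complementary cones. -/

section ComplementaryCones

open Classical

/-- A nontrivial nonnegative linear relation can be normalised to a convex one. -/
theorem exists_mem_stdSimplex_of_nonneg_relation {V κ : Type*} [AddCommGroup V] [Module ℝ V]
    [Fintype κ] {e : κ → V} {a : κ → ℝ} (ha0 : ∀ l, 0 ≤ a l) (ha : ∑ l, a l • e l = 0)
    (hne : a ≠ 0) : ∃ w ∈ stdSimplex ℝ κ, ∑ l, w l • e l = 0 := by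
  have hpos : 0 < ∑ l, a l := by
    refine lt_of_le_of_ne (Finset.sum_nonneg fun l _ => ha0 l) fun h => hne ?_
    funext l
    exact (Finset.sum_eq_zero_iff_of_nonneg fun l _ => ha0 l).mp h.symm l (Finset.mem_univ l)
  refine ⟨fun l => (∑ l, a l)⁻¹ * a l,
    ⟨fun l => mul_nonneg (inv_nonneg.mpr hpos.le) (ha0 l), ?_⟩, ?_⟩
  · rw [← Finset.mul_sum, inv_mul_cancel₀ hpos.ne']
  · simp [mul_smul, ← Finset.smul_sum, ha]

theorem isClosed_setOf_exists_mem_stdSimplex_relation {V ι : Type*} [NormedAddCommGroup V]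
    [NormedSpace ℝ V] [Fintype ι] (g : ι → V) :
    IsClosed {z : V | ∃ w ∈ stdSimplex ℝ (Option ι),
      ∑ l, w l • (l.elim z g : V) = 0} := by
  have hcont : Continuous fun x : stdSimplex ℝ (Option ι) × V =>
      ∑ l, (x.1 : Option ι → ℝ) l • (l.elim x.2 g : V) := by
    refine continuous_finsetSum _ fun l _ => ?_
    have h1 : Continuous fun x : stdSimplex ℝ (Option ι) × V => (x.1 : Option ι → ℝ) l :=
      (continuous_apply l).comp (continuous_subtype_val.comp continuous_fst)
    cases l with
    | none => exact h1.smul continuous_snd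
    | some j => exact h1.smul continuous_const
  have : CompactSpace (stdSimplex ℝ (Option ι)) :=
    isCompact_iff_compactSpace.mp (isCompact_stdSimplex ℝ _)
  have := isClosedMap_snd_of_compactSpace (X := stdSimplex ℝ (Option ι)) (Y := V) _
    (isClosed_singleton (x := (0 : V)) |>.preimage hcont)
  convert this using 1
  ext z
  constructor
  · rintro ⟨w, hw, h⟩
    exact ⟨(⟨w, hw⟩, z), h, rfl⟩
  · rintro ⟨⟨w, z'⟩, h, rfl⟩
    exact ⟨w, w.2, h⟩

theorem exists_mem_forall_isGenericFor {V κ Φ : Type*} [NormedAddCommGroup V] [NormedSpace ℝ V]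
    [FiniteDimensional ℝ V] [Finite κ] [Finite Φ] (e : Φ → κ → V) {U : Set V} (hU : IsOpen U)
    (hne : U.Nonempty) : ∃ z ∈ U, ∀ F, IsGenericFor (e F) z := by
  let W : Φ × Set κ → Submodule ℝ V := fun x => Submodule.span ℝ (e x.1 '' x.2)
  have hdense : Dense (⋂ x : {x // W x ≠ ⊤}, ((W x : Set V))ᶜ) := by
    have := FiniteDimensional.complete ℝ V
    refine dense_iInter_of_isOpen
      (fun x => (Submodule.closed_of_finiteDimensional (W x)).isOpen_compl) fun x => ?_
    rw [← interior_eq_empty_iff_dense_compl, Set.eq_empty_iff_forall_notMem]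
    exact fun y hy => x.2 (Submodule.eq_top_of_nonempty_interior' (W x) ⟨y, hy⟩)
  obtain ⟨z, hzU, hz⟩ := hdense.inter_open_nonempty U hU hne
  refine ⟨z, hzU, fun F B hB => ?_⟩
  by_contra h
  exact Set.mem_iInter.mp hz ⟨(F, B), h⟩ hB

/-- For fixed `j`, flipping the `j`-th choice is a fixed-point-free involution. -/
theorem even_card_of_flip_invariant {ι : Type*} [Fintype ι] (E : (ι → Bool) → ι → Prop)
    (hE : ∀ F j, E F j → E (Function.update F j (!F j)) j) :
    Even (∑ F : ι → Bool, (Finset.univ.filter fun j => E F j).card) := by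
  have hcomm : ∑ F : ι → Bool, (Finset.univ.filter fun j => E F j).card =
      ∑ j : ι, (Finset.univ.filter fun F => E F j).card := by
    simp only [Finset.card_filter]
    exact Finset.sum_comm
  rw [hcomm]
  refine Finset.even_sum _ fun j _ => ?_
  rw [Finset.card_filter, ← ZMod.natCast_eq_zero_iff_even]
  push_cast
  refine Finset.sum_involution (fun F _ => Function.update F j (!F j)) ?_ ?_ ?_ ?_
  · intro F _
    have : E F j ↔ E (Function.update F j (!F j)) j :=
      ⟨hE F j, fun h => by simpa using hE _ j h⟩
    by_cases h : E F j
    · rw [if_pos h, if_pos (this.mp h)]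
      rfl
    · rw [if_neg h, if_neg (mt this.mpr h), add_zero]
  · intro F _ _ h
    simpa using congrFun h j
  · simp
  · simp

/-- If the positive vector `p` lies in exactly one of the `2 ^ |ι|` cones spanned by choosing one
vector from each pair `f j true`, `f j false`, then these cones cover the space, unless
one of them fails to be pointed. -/
theorem exists_choice_mem_stdSimplex_relation {V ι : Type*} [NormedAddCommGroup V]
    [NormedSpace ℝ V] [FiniteDimensional ℝ V] [Fintype ι]
    (hcard : Fintype.card ι = Module.finrank ℝ V) (f : ι → Bool → V)
    (hli : LinearIndependent ℝ fun j => f j true) {c : ι → ℝ} (hc : ∀ j, 0 < c j)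
    (huniq : ∀ (F : ι → Bool) (a : ι → ℝ), (∀ j, 0 ≤ a j) →
      ∑ j, a j • f j (F j) = ∑ j, c j • f j true → F = fun _ => true) (z : V) :
    ∃ F : ι → Bool, ∃ w ∈ stdSimplex ℝ (Option ι),
      ∑ l, w l • (l.elim z fun j => f j (F j) : V) = 0 := by
  by_contra hcon
  set p := ∑ j, c j • f j true with hp
  have hpointed : ∀ (F : ι → Bool) (a : ι → ℝ), (∀ j, 0 ≤ a j) →
      ∑ j, a j • f j (F j) = 0 → a = 0 := by
    intro F a ha0 ha
    by_contra hne
    refine hcon ⟨F, exists_mem_stdSimplex_of_nonneg_relation (a := fun l => l.elim 0 a) ?_ ?_ ?_⟩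
    · rintro (_ | j)
      exacts [le_rfl, ha0 j]
    · simpa [Fintype.sum_option] using ha
    · exact fun h => hne (funext fun j => congrFun h (some j))
  -- With `-p` as extra vector, solutions of weight `t` on `none` are the points `q + t • p` of the
  -- cone of `F`.
  let e : (ι → Bool) → Option ι → V := fun F l => l.elim (-p) fun j => f j (F j)
  let T : Set V := ⋃ F : ι → Bool, {z : V | ∃ w ∈ stdSimplex ℝ (Option ι),
      ∑ l, w l • (l.elim z fun j => f j (F j) : V) = 0}
  have hT : IsClosed T :=
    isClosed_iUnion_of_finite fun F => isClosed_setOf_exists_mem_stdSimplex_relation _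
  -- The bad set is closed, so `-z` can be perturbed to a generic `q` outside every cone.
  have hzT : z ∈ Tᶜ := fun h => hcon (Set.mem_iUnion.mp h)
  obtain ⟨q, hqT, hq⟩ := exists_mem_forall_isGenericFor e
    (hT.isOpen_compl.preimage (continuous_neg (G := V)))
    ⟨-z, by simpa using hzT⟩
  have hκ : Fintype.card (Option ι) = Module.finrank ℝ V + 1 := by
    rw [Fintype.card_option, hcard]
  have hnone : ∀ F, ¬ HasSolutionVanishingAt (e F) q none := by
    rintro F ⟨a, ha0, han, ha⟩
    refine hqT (Set.mem_iUnion.mpr ⟨F, exists_mem_stdSimplex_of_nonneg_relation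
      (a := fun l => l.elim 1 fun j => a (some j)) ?_ ?_ ?_⟩)
    · rintro (_ | j)
      exacts [zero_le_one, ha0 _]
    · rw [Fintype.sum_option] at ha ⊢
      simp only [e, Option.elim, han, zero_smul, zero_add] at ha ⊢
      rw [ha]
      simp
    · exact fun h => one_ne_zero (congrFun h none)
  have hcount : ∀ F, (Finset.univ.filter fun j => HasSolutionVanishingAt (e F) q (some j)).card =
      (Finset.univ.filter fun l => HasSolutionVanishingAt (e F) q l).card := by
    intro F
    simp only [Finset.card_filter, Fintype.sum_option]
    rw [if_neg (hnone F), zero_add]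
  have heven : Even (∑ F : ι → Bool,
      (Finset.univ.filter fun j => HasSolutionVanishingAt (e F) q (some j)).card) := by
    -- A facet omitting `j` does not depend on `F j`.
    refine even_card_of_flip_invariant _ ?_
    rintro F j ⟨a, ha0, haj, ha⟩
    refine ⟨a, ha0, haj, ?_⟩
    rw [← ha]
    refine Finset.sum_congr rfl ?_
    rintro (_ | l) -
    · rfl
    · by_cases h : l = j
      · rw [h, haj, zero_smul, zero_smul]
      · simp [e, Function.update_of_ne h]
  have hone : (Finset.univ.filter fun j =>
      HasSolutionVanishingAt (e fun _ => true) q (some j)).card = 1 := by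
    rw [hcount]
    have hspan := hli.span_eq_top_of_card_eq_finrank' hcard
    obtain ⟨b, hb⟩ := (Submodule.mem_span_range_iff_exists_fun ℝ).mp
      (hspan ▸ Submodule.mem_top : q ∈ Submodule.span ℝ (Set.range fun j => f j true))
    refine (hq _).card_hasSolutionVanishingAt_eq_one hκ (a := fun l => l.elim 0 b)
      (c := fun l => l.elim 1 c) ?_ ?_ ?_
    · simpa [Fintype.sum_option, e] using hb
    · simp [Fintype.sum_option, e, hp]
    · rintro (_ | j)
      exacts [zero_lt_one, hc j]
  have hother : ∀ F : ι → Bool, F ≠ (fun _ => true) →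
      Even (Finset.univ.filter fun j => HasSolutionVanishingAt (e F) q (some j)).card := by
    intro F hF
    rw [hcount]
    refine (hq F).even_card_hasSolutionVanishingAt hκ fun a ha0 ha => ?_
    simp only [Fintype.sum_option, e, Option.elim] at ha
    have ha' : ∑ j, a (some j) • f j (F j) = a none • p := by
      rw [smul_neg, neg_add_eq_zero] at ha
      exact ha.symm
    -- Otherwise dividing by `a none` would put `p` in the cone of `F`.
    have hn : a none = 0 := by
      by_contra hne
      refine hF (huniq F (fun j => (a none)⁻¹ * a (some j))
        (fun j => mul_nonneg (inv_nonneg.mpr (ha0 _)) (ha0 _)) ?_)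
      simp only [mul_smul, ← Finset.smul_sum]
      rw [ha', inv_smul_smul₀ hne]
    rw [hn, zero_smul] at ha'
    have h0 := hpointed F (fun j => a (some j)) (fun j => ha0 _) ha'
    funext l
    cases l with
    | none => exact hn
    | some j => exact congrFun h0 j
  rw [← Finset.add_sum_erase _ _ (Finset.mem_univ fun _ => true), hone] at heven
  have : Even (∑ F ∈ Finset.univ.erase (fun _ : ι => true),
      (Finset.univ.filter fun j => HasSolutionVanishingAt (e F) q (some j)).card) :=
    Finset.even_sum _ fun F hF => hother F (Finset.ne_of_mem_erase hF)
  rw [Nat.even_add] at heven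
  exact Nat.not_even_one (heven.mpr this)

end ComplementaryCones

theorem mem_convexHull_range_iff {V ι : Type*} [AddCommGroup V] [Module ℝ V] [Fintype ι]
    {x : ι → V} {v : V} :
    v ∈ convexHull ℝ (Set.range x) ↔ ∃ w ∈ stdSimplex ℝ ι, ∑ i, w i • x i = v := by
  classical
  constructor
  · intro hv
    have hconv : Convex ℝ {v : V | ∃ w ∈ stdSimplex ℝ ι, ∑ i, w i • x i = v} := by
      have := (convex_stdSimplex ℝ ι).linear_image (Fintype.linearCombination ℝ x)
      convert this using 1
      ext v
      simp [Fintype.linearCombination_apply]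
    refine convexHull_min ?_ hconv hv
    rintro _ ⟨i, rfl⟩
    exact ⟨Pi.single i 1, single_mem_stdSimplex ℝ i, by simp [Pi.single_apply]⟩
  · rintro ⟨w, hw, rfl⟩
    exact (convex_convexHull ℝ _).sum_mem (fun i _ => hw.1 i) hw.2
      fun i _ => subset_convexHull ℝ _ ⟨i, rfl⟩

/-! ### The nearest transversal point. -/

section InnerProduct

open RealInnerProductSpace

variable {V : Type*} [NormedAddCommGroup V] [InnerProductSpace ℝ V]

theorem norm_sq_le_inner_of_forall_norm_le {C : Set V} (hC : Convex ℝ C) {p v : V}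
    (hp : p ∈ C) (hmin : ∀ u ∈ C, ‖p‖ ≤ ‖u‖) (hv : v ∈ C) : ‖p‖ ^ 2 ≤ ⟪p, v⟫ := by
  have : Nonempty C := ⟨⟨p, hp⟩⟩
  have h : ‖(0 : V) - p‖ = ⨅ u : C, ‖(0 : V) - u‖ := by
    refine le_antisymm (le_ciInf fun u => ?_)
      (ciInf_le (f := fun u : C => ‖(0 : V) - u‖) ⟨0, ?_⟩ ⟨p, hp⟩)
    · simpa using hmin u u.2
    · rintro _ ⟨u, rfl⟩
      exact norm_nonneg _
  have := (norm_eq_iInf_iff_real_inner_le_zero hC hp).mp h v hv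
  rw [zero_sub, inner_neg_left, inner_sub_right, real_inner_self_eq_norm_sq] at this
  linarith

theorem le_inner_of_mem_convexHull {s : Set V} {p y : V} {m : ℝ} (h : ∀ x ∈ s, m ≤ ⟪p, x⟫)
    (hy : y ∈ convexHull ℝ s) : m ≤ ⟪p, y⟫ :=
  convexHull_min (t := {x | m ≤ ⟪p, x⟫}) h
    (convex_halfSpace_ge (f := fun x => ⟪p, x⟫)
      ⟨fun _ _ => inner_add_right _ _ _, fun _ _ => real_inner_smul_right _ _ _⟩ m) hy

/-- A point `p` of minimal norm among the convex hulls of the transversals of `S`. -/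
structure IsNearestTransversalPoint {ι : Type*} (S : ι → Finset V) (p : V) : Prop where
  exists_mem : ∃ x : ι → V, (∀ i, x i ∈ S i) ∧ p ∈ convexHull ℝ (Set.range x)
  norm_le : ∀ x : ι → V, (∀ i, x i ∈ S i) → ∀ v ∈ convexHull ℝ (Set.range x), ‖p‖ ≤ ‖v‖

variable {ι : Type*} {S : ι → Finset V} {p : V}

/-- The ray from every point of `S k` through the origin meets the convex hull of `S i ∪ S j`
beyond its starting point. -/
def Shields (S : ι → Finset V) (i j k : ι) : Prop :=
  ∀ x ∈ S k, ∃ s : ℝ, s < 1 ∧ s • x ∈ convexHull ℝ ((S i : Set V) ∪ S j)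

theorem Shields.symm {i j k : ι} (h : Shields S i j k) : Shields S j i k := by
  rwa [Shields, Set.union_comm]

/-- Since `s < 1`, the point `s • y` is strictly lower than `y` in direction `p`, so some point
spanning the hull is too. -/
theorem Shields.exists_inner_lt {i j k : ι} (h : Shields S i j k) {y : V} (hy : y ∈ S k)
    (hpos : 0 < ⟪p, y⟫) : ∃ u, (u ∈ S i ∨ u ∈ S j) ∧ ⟪p, u⟫ < ⟪p, y⟫ := by
  obtain ⟨s, hs, hmem⟩ := h y hy
  by_contra! hcon
  have := le_inner_of_mem_convexHull (p := p) (m := ⟪p, y⟫)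
    (fun u hu => hcon u (by simpa using hu)) hmem
  rw [real_inner_smul_right] at this
  nlinarith

variable [Fintype ι] {x : ι → V} {w : ι → ℝ}

theorem exists_isNearestTransversalPoint [Nonempty ι] (hne : ∀ i, (S i).Nonempty) :
    ∃ p, IsNearestTransversalPoint S p := by
  classical
  let Z : Set V := ⋃ x ∈ Fintype.piFinset S, convexHull ℝ (Set.range x)
  have hZ : IsCompact Z :=
    (Fintype.piFinset S).isCompact_biUnion fun x _ => (Set.finite_range x).isCompact_convexHull ℝ
  have hZne : Z.Nonempty := by
    choose x hx using hne
    obtain ⟨i⟩ := ‹Nonempty ι›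
    exact ⟨x i, Set.mem_biUnion (Fintype.mem_piFinset.mpr hx) (subset_convexHull ℝ _ ⟨i, rfl⟩)⟩
  obtain ⟨p, hpZ, hp⟩ := hZ.exists_isMinOn hZne continuous_norm.continuousOn
  obtain ⟨x, hx, hpx⟩ := Set.mem_iUnion₂.mp hpZ
  exact ⟨p, ⟨x, Fintype.mem_piFinset.mp hx, hpx⟩, fun x hx v hv =>
    hp (Set.mem_biUnion (Fintype.mem_piFinset.mpr hx) hv)⟩

theorem IsNearestTransversalPoint.norm_sq_le_inner (hp : IsNearestTransversalPoint S p)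
    (hx : ∀ i, x i ∈ S i) (hw : w ∈ stdSimplex ℝ ι) (hwx : ∑ i, w i • x i = p) (i : ι) :
    ‖p‖ ^ 2 ≤ ⟪p, x i⟫ :=
  norm_sq_le_inner_of_forall_norm_le (convex_convexHull ℝ (Set.range x))
    (mem_convexHull_range_iff.mpr ⟨w, hw, hwx⟩) (hp.norm_le x hx)
    (subset_convexHull ℝ _ ⟨i, rfl⟩)

/-- A point of weight zero can be exchanged within its colour without moving `p`. -/
theorem IsNearestTransversalPoint.norm_sq_le_inner_of_weight_eq_zero
    (hp : IsNearestTransversalPoint S p) (hx : ∀ i, x i ∈ S i) (hw : w ∈ stdSimplex ℝ ι)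
    (hwx : ∑ i, w i • x i = p) {i : ι} (hi : w i = 0) {y : V} (hy : y ∈ S i) :
    ‖p‖ ^ 2 ≤ ⟪p, y⟫ := by
  classical
  have := hp.norm_sq_le_inner (x := Function.update x i y) (w := w) (fun j => ?_) hw ?_ i
  · simpa using this
  · by_cases h : j = i
    · subst h
      simpa using hy
    · simpa [h] using hx j
  · rw [← hwx]
    refine Finset.sum_congr rfl fun j _ => ?_
    by_cases h : j = i
    · rw [h, hi, zero_smul, zero_smul]
    · rw [Function.update_of_ne h]

theorem IsNearestTransversalPoint.inner_eq_of_weight_ne_zero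
    (hp : IsNearestTransversalPoint S p) (hx : ∀ i, x i ∈ S i) (hw : w ∈ stdSimplex ℝ ι)
    (hwx : ∑ i, w i • x i = p) {i : ι} (hi : w i ≠ 0) : ⟪p, x i⟫ = ‖p‖ ^ 2 := by
  have hsum : ∑ i, w i * (⟪p, x i⟫ - ‖p‖ ^ 2) = 0 := by
    have h1 : ∑ i, w i * ⟪p, x i⟫ = ‖p‖ ^ 2 := by
      simp only [← real_inner_smul_right]
      rw [← inner_sum, hwx, real_inner_self_eq_norm_sq]
    simp only [mul_sub, Finset.sum_sub_distrib]
    rw [h1, ← Finset.sum_mul, hw.2, one_mul, sub_self]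
  have h := (Finset.sum_eq_zero_iff_of_nonneg fun i _ => mul_nonneg (hw.1 i)
    (sub_nonneg.mpr (hp.norm_sq_le_inner hx hw hwx i))).mp hsum i (Finset.mem_univ i)
  rcases mul_eq_zero.mp h with h | h
  · exact absurd h hi
  · linarith

open Classical in
theorem sum_subtype_ne_zero_smul {g : ι → ℝ} (h : ∀ i, w i = 0 → g i = 0) :
    ∑ j : {j // w j ≠ 0}, g j • x j = ∑ i, g i • x i := by
  rw [← Finset.sum_subset (Finset.subset_univ (Finset.univ.filter fun i => w i ≠ 0)),
    Finset.sum_subtype (p := fun i => w i ≠ 0) _ (by simp) fun i => g i • x i]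
  intro i _ hi
  rw [h i (by simpa using hi), zero_smul]

open Classical in
/-- Carathéodory's reduction: vectors on a hyperplane off the origin that occur in a convex
combination of minimal support are linearly independent. -/
theorem linearIndependent_of_minimal_support (hp0 : p ≠ 0) (hw : w ∈ stdSimplex ℝ ι)
    (hwx : ∑ i, w i • x i = p) (hinner : ∀ i, w i ≠ 0 → ⟪p, x i⟫ = ‖p‖ ^ 2)
    (hmin : ∀ w' ∈ stdSimplex ℝ ι, ∑ i, w' i • x i = p →
      (Finset.univ.filter fun i => w i ≠ 0).card ≤ (Finset.univ.filter fun i => w' i ≠ 0).card) :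
    LinearIndependent ℝ fun i : {i // w i ≠ 0} => x i := by
  by_contra hnot
  obtain ⟨c, hc, i₀, hi₀⟩ := Fintype.not_linearIndependent_iff.mp hnot
  let g : ι → ℝ := fun i => if h : w i ≠ 0 then c ⟨i, h⟩ else 0
  have hgw : ∀ i, w i = 0 → g i = 0 := fun i hi => by simp [g, hi]
  have hgc : ∀ i : {i // w i ≠ 0}, g i = c i := fun i => by simp [g, i.2]
  have hgx : ∑ i, g i • x i = 0 := by
    rw [← sum_subtype_ne_zero_smul hgw]
    simpa only [hgc] using hc
  -- Pairing the relation with `p` shows that it preserves the total weight.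
  have hgsum : ∑ i, g i = 0 := by
    have h1 : ∑ i, g i * ‖p‖ ^ 2 = 0 := by
      calc ∑ i, g i * ‖p‖ ^ 2 = ∑ i, ⟪p, g i • x i⟫ := by
            refine Finset.sum_congr rfl fun i _ => ?_
            by_cases h : w i = 0
            · simp [hgw i h]
            · rw [real_inner_smul_right, hinner i h]
        _ = 0 := by rw [← inner_sum, hgx, inner_zero_right]
    rw [← Finset.sum_mul] at h1
    exact (mul_eq_zero.mp h1).resolve_right (pow_ne_zero 2 (norm_ne_zero_iff.mpr hp0))
  obtain ⟨m, hm⟩ : ∃ m, g m < 0 := by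
    by_contra! h
    refine hi₀ ?_
    rw [← hgc]
    exact (Finset.sum_eq_zero_iff_of_nonneg fun i _ => h i).mp hgsum i₀ (Finset.mem_univ _)
  obtain ⟨l, hl, hlmin⟩ := Finset.exists_min_image (Finset.univ.filter fun l => g l < 0)
    (fun l => w l / (-g l)) ⟨m, by simpa using hm⟩
  have hgl : g l < 0 := by simpa using hl
  have hwl : w l ≠ 0 := fun h => by rw [hgw l h] at hgl; exact lt_irrefl _ hgl
  set s := w l / (-g l) with hs
  have hs0 : 0 ≤ s := div_nonneg (hw.1 l) (by linarith)
  have hzero : w l + s * g l = 0 := by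
    have : g l ≠ 0 := hgl.ne
    rw [hs]
    field_simp
    ring
  have hle := hmin (fun i => w i + s * g i) ⟨fun i => ?_, ?_⟩ ?_
  · refine absurd hle (not_le.mpr (Finset.card_lt_card ⟨fun i hi => ?_, fun h => ?_⟩))
    · simp only [Finset.mem_filter, Finset.mem_univ, true_and] at hi ⊢
      intro h
      exact hi (by rw [h, hgw i h, mul_zero, add_zero])
    · have := h (Finset.mem_filter.mpr ⟨Finset.mem_univ l, hwl⟩)
      exact (Finset.mem_filter.mp this).2 hzero
  · show 0 ≤ w i + s * g i
    by_cases h : g i < 0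
    · have h1 := hlmin i (by simpa using h)
      rw [le_div_iff₀ (by linarith)] at h1
      linarith
    · linarith [hw.1 i, mul_nonneg hs0 (not_lt.mp h)]
  · rw [Finset.sum_add_distrib, ← Finset.mul_sum, hgsum, hw.2, mul_zero, add_zero]
  · simp only [add_smul, mul_smul, Finset.sum_add_distrib, ← Finset.smul_sum, hwx, hgx,
      smul_zero, add_zero]

theorem IsNearestTransversalPoint.exists_linearIndependent (hp : IsNearestTransversalPoint S p)
    (hp0 : p ≠ 0) : ∃ x : ι → V, (∀ i, x i ∈ S i) ∧ ∃ w ∈ stdSimplex ℝ ι,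
      ∑ i, w i • x i = p ∧ LinearIndependent ℝ fun i : {i // w i ≠ 0} => x i := by
  classical
  obtain ⟨x, hx, hpx⟩ := hp.exists_mem
  obtain ⟨w₀, hw₀⟩ := mem_convexHull_range_iff.mp hpx
  obtain ⟨w, ⟨hw, hwx⟩, hmin⟩ := exists_minimalFor_of_wellFoundedLT
    (fun w : ι → ℝ => w ∈ stdSimplex ℝ ι ∧ ∑ i, w i • x i = p)
    (fun w => (Finset.univ.filter fun i => w i ≠ 0).card) ⟨w₀, hw₀⟩
  refine ⟨x, hx, w, hw, hwx, linearIndependent_of_minimal_support hp0 hw hwx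
    (fun i hi => hp.inner_eq_of_weight_ne_zero hx hw hwx hi) fun w' hw' hwx' => ?_⟩
  by_contra hlt
  exact hlt (hmin ⟨hw', hwx'⟩ (not_le.mp hlt).le)

/-- At most one colour is missing from a convex combination that realises the nearest point. -/
theorem IsNearestTransversalPoint.eq_of_weight_eq_zero (hp : IsNearestTransversalPoint S p)
    (hp0 : p ≠ 0) (hne : ∀ i, (S i).Nonempty)
    (hS : ∀ i j, i ≠ j → ∃ k, k ≠ i ∧ k ≠ j ∧ Shields S i j k)
    (hx : ∀ i, x i ∈ S i) (hw : w ∈ stdSimplex ℝ ι) (hwx : ∑ i, w i • x i = p) {i j : ι}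
    (hi : w i = 0) (hj : w j = 0) : i = j := by
  classical
  by_contra hij
  have hpp : 0 < ‖p‖ ^ 2 := by positivity
  choose y hy hmin using fun k => Finset.exists_min_image (S k) (fun u => ⟪p, u⟫) (hne k)
  let M : Finset ι := Finset.univ.filter fun k => w k = 0
  -- `i₁` and `i₂` are the missing colours whose lowest points are highest in direction `p`, so a
  -- missing shield `k` would have its lowest point no higher than theirs.
  obtain ⟨i₁, hi₁, hmax₁⟩ := M.exists_max_image (fun k => ⟪p, y k⟫) ⟨i, by simpa [M] using hi⟩
  have hM : (M.erase i₁).Nonempty := by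
    by_cases h : i = i₁
    · exact ⟨j, by simp [M, hj, ← h, Ne.symm hij]⟩
    · exact ⟨i, by simp [M, hi, h]⟩
  obtain ⟨i₂, hi₂, hmax₂⟩ := (M.erase i₁).exists_max_image (fun k => ⟪p, y k⟫) hM
  obtain ⟨hne₂, hi₂⟩ := Finset.mem_erase.mp hi₂
  have hwi₁ : w i₁ = 0 := by simpa [M] using hi₁
  have hwi₂ : w i₂ = 0 := by simpa [M] using hi₂
  obtain ⟨k, hk₁, hk₂, hk⟩ := hS i₁ i₂ hne₂.symm
  by_cases hwk : w k = 0
  · have hpk := hp.norm_sq_le_inner_of_weight_eq_zero hx hw hwx hwk (hy k)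
    obtain ⟨u, hu, hlt⟩ := hk.exists_inner_lt (p := p) (hy k) (by linarith)
    have h₂ := hmax₂ k (by simp [M, hwk, hk₁])
    have h₁ := hmax₁ i₂ hi₂
    rcases hu with hu | hu
    · linarith [hmin i₁ u hu]
    · linarith [hmin i₂ u hu]
  · have hpk := hp.inner_eq_of_weight_ne_zero hx hw hwx hwk
    obtain ⟨u, hu, hlt⟩ := hk.exists_inner_lt (p := p) (hx k) (by linarith)
    rcases hu with hu | hu
    · linarith [hp.norm_sq_le_inner_of_weight_eq_zero hx hw hwx hwi₁ hu]
    · linarith [hp.norm_sq_le_inner_of_weight_eq_zero hx hw hwx hwi₂ hu]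

/-- A colourful Carathéodory theorem: shielded colour classes have a transversal whose convex hull
contains the origin. -/
theorem exists_transversal_zero_mem_convexHull [FiniteDimensional ℝ V]
    (hcard : Fintype.card ι = Module.finrank ℝ V + 1) (hne : ∀ i, (S i).Nonempty)
    (hS : ∀ i j, i ≠ j → ∃ k, k ≠ i ∧ k ≠ j ∧ Shields S i j k) :
    ∃ x : ι → V, (∀ i, x i ∈ S i) ∧ (0 : V) ∈ convexHull ℝ (Set.range x) := by
  classical
  have : Nonempty ι := Fintype.card_pos_iff.mp (by omega)
  obtain ⟨p, hp⟩ := exists_isNearestTransversalPoint hne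
  by_cases hp0 : p = 0
  · exact hp0 ▸ hp.exists_mem
  have hpp : 0 < ‖p‖ ^ 2 := by positivity
  obtain ⟨x, hx, w, hw, hwx, hli⟩ := hp.exists_linearIndependent hp0
  obtain ⟨i, hi⟩ : ∃ i, w i = 0 := by
    by_contra! h
    have h1 := hli.fintype_card_le_finrank
    rw [Fintype.card_subtype, Finset.filter_true_of_mem fun i _ => h i, Finset.card_univ] at h1
    omega
  have hwne : ∀ j, w j ≠ 0 ↔ j ≠ i := fun j =>
    not_congr ⟨fun h => hp.eq_of_weight_eq_zero hp0 hne hS hx hw hwx h hi, fun h => h ▸ hi⟩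
  have hbelow : ∀ j : {j // w j ≠ 0}, ∃ y ∈ S j, ⟪p, y⟫ < ‖p‖ ^ 2 := by
    rintro ⟨j, hj⟩
    obtain ⟨k, hki, hkj, hk⟩ := hS i j (Ne.symm ((hwne j).mp hj))
    have hpk := hp.inner_eq_of_weight_ne_zero hx hw hwx ((hwne k).mpr hki)
    obtain ⟨u, hu, hlt⟩ := hk.exists_inner_lt (p := p) (hx k) (by linarith)
    rw [hpk] at hlt
    rcases hu with hu | hu
    · linarith [hp.norm_sq_le_inner_of_weight_eq_zero hx hw hwx hi hu]
    · exact ⟨u, hu, hlt⟩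
  choose y hy hylt using hbelow
  obtain ⟨z, hz⟩ := hne i
  let f : {j // w j ≠ 0} → Bool → V := fun j b => if b then x j else y j
  have hfS : ∀ (j : {j // w j ≠ 0}) b, f j b ∈ S j := by
    rintro j (_ | _)
    exacts [by simpa [f] using hy j, by simpa [f] using hx j]
  have hfp : ∀ j b, ⟪p, f j b⟫ ≤ ‖p‖ ^ 2 := by
    rintro j (_ | _)
    exacts [by simpa [f] using (hylt j).le,
      by simpa [f] using (hp.inner_eq_of_weight_ne_zero hx hw hwx j.2).le]
  have hsupp : ∑ j : {j // w j ≠ 0}, w j • f j true = p := by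
    rw [← hwx, ← sum_subtype_ne_zero_smul (w := w) (g := w) fun _ h => h]
    simp [f]
  let extend : ({j // w j ≠ 0} → Bool) → ι → V := fun F l =>
    if h : w l ≠ 0 then f ⟨l, h⟩ (F ⟨l, h⟩) else z
  have hextend : ∀ F l, extend F l ∈ S l := by
    intro F l
    by_cases h : w l = 0
    · have : l = i := by
        by_contra hl
        exact (hwne l).mpr hl h
      subst this
      simpa [extend, h] using hz
    · simpa [extend, h] using hfS ⟨l, h⟩ _
  have hextend_some : ∀ F (j : {j // w j ≠ 0}), extend F j = f j (F j) := fun F j => by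
    simp [extend, j.2]
  have hconv : ∀ F v (w' : Option {j // w j ≠ 0} → ℝ), w' ∈ stdSimplex ℝ _ →
      ∑ l, w' l • (l.elim z fun j => f j (F j) : V) = v →
      v ∈ convexHull ℝ (Set.range (extend F)) := by
    rintro F _ w' hw' rfl
    refine (convex_convexHull ℝ _).sum_mem (fun l _ => hw'.1 l) hw'.2 fun l _ =>
      subset_convexHull ℝ _ ?_
    cases l with
    | none => exact ⟨i, by simp [extend, hi]⟩
    | some j => exact ⟨j.1, hextend_some F j⟩
  have hcard' : Fintype.card {j // w j ≠ 0} = Module.finrank ℝ V := by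
    rw [Fintype.card_congr (Equiv.subtypeEquivRight hwne), Fintype.card_subtype_compl,
      Fintype.card_subtype_eq, hcard]
    rfl
  have huniq : ∀ (F : {j // w j ≠ 0} → Bool) (a : {j // w j ≠ 0} → ℝ), (∀ j, 0 ≤ a j) →
      ∑ j, a j • f j (F j) = ∑ j : {j // w j ≠ 0}, w j • f j true → F = fun _ => true := by
    intro F a ha0 ha
    rw [hsupp] at ha
    set A := ∑ j, a j with hA
    have hApos : 0 < A := by
      refine lt_of_le_of_ne (Finset.sum_nonneg fun j _ => ha0 j) fun h => hp0 ?_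
      have h0 := (Finset.sum_eq_zero_iff_of_nonneg fun j _ => ha0 j).mp h.symm
      rw [← ha]
      exact Finset.sum_eq_zero fun j hj => by rw [h0 j hj, zero_smul]
    -- `A⁻¹ • p` lies in a transversal hull, so its norm is at least `‖p‖`.
    have hA1 : A ≤ 1 := by
      have hmem : A⁻¹ • p ∈ convexHull ℝ (Set.range (extend F)) := by
        refine hconv F _ (fun l => l.elim 0 fun j => A⁻¹ * a j) ⟨?_, ?_⟩ ?_
        · rintro (_ | j)
          exacts [le_rfl, mul_nonneg (inv_nonneg.mpr hApos.le) (ha0 j)]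
        · simp [Fintype.sum_option, ← Finset.mul_sum, ← hA, hApos.ne']
        · simp [Fintype.sum_option, mul_smul, ← Finset.smul_sum, ha]
      have h1 := hp.norm_le _ (hextend F) _ hmem
      rw [norm_smul, norm_inv, Real.norm_of_nonneg hApos.le, inv_mul_eq_div,
        le_div_iff₀ hApos] at h1
      exact le_of_mul_le_mul_left (by simpa using h1) (norm_pos_iff.mpr hp0)
    have hinner : ∑ j, a j * ⟪p, f j (F j)⟫ = ‖p‖ ^ 2 := by
      simp only [← real_inner_smul_right]
      rw [← inner_sum, ha, real_inner_self_eq_norm_sq]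
    -- Equality throughout `‖p‖ ^ 2 ≤ A * ‖p‖ ^ 2 ≤ ‖p‖ ^ 2` kills the weight of every `y j`; linear
    -- independence then gives `a = w`.
    have hgap : ∑ j, a j * (‖p‖ ^ 2 - ⟪p, f j (F j)⟫) = 0 := by
      refine le_antisymm ?_
        (Finset.sum_nonneg fun j _ => mul_nonneg (ha0 j) (sub_nonneg.mpr (hfp j _)))
      simp only [mul_sub, Finset.sum_sub_distrib]
      rw [hinner, ← Finset.sum_mul]
      nlinarith
    have hzero : ∀ j : {j // w j ≠ 0}, F j = false → a j = 0 := by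
      intro j hj
      have h := (Finset.sum_eq_zero_iff_of_nonneg fun j _ => mul_nonneg (ha0 j)
        (sub_nonneg.mpr (hfp j (F j)))).mp hgap j (Finset.mem_univ j)
      refine (mul_eq_zero.mp h).resolve_right ?_
      have := hylt j
      simp only [hj, f]
      exact (sub_pos.mpr (by simpa using this)).ne'
    have hdiff : ∑ j : {j // w j ≠ 0}, (a j - w j) • x j = 0 := by
      simp only [sub_smul, Finset.sum_sub_distrib]
      rw [sub_eq_zero]
      calc ∑ j, a j • x j = ∑ j, a j • f j (F j) := by
            refine Finset.sum_congr rfl fun j _ => ?_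
            cases hF : F j
            · rw [hzero j hF, zero_smul, zero_smul]
            · simp [f]
        _ = ∑ j : {j // w j ≠ 0}, w j • x j := by rw [ha, ← hsupp]; simp [f]
    funext j
    by_contra hF
    have h1 := Fintype.linearIndependent_iff.mp hli _ hdiff j
    rw [hzero j (by simpa using hF), zero_sub, neg_eq_zero] at h1
    exact j.2 h1
  obtain ⟨F, w', hw', h0⟩ := exists_choice_mem_stdSimplex_relation hcard' f
    (by simpa [f] using hli) (c := fun j => w j)
    (fun j => lt_of_le_of_ne (hw.1 j) (Ne.symm j.2)) huniq z
  exact ⟨extend F, hextend F, hconv F 0 w' hw' h0⟩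

end InnerProduct

theorem theorem1 (d : ℕ) (S : Fin (d + 1) → Finset (EuclideanSpace ℝ (Fin d)))
    (hne : ∀ i, (S i).Nonempty)
    (hS : ∀ i j : Fin (d + 1), i < j → ∃ k : Fin (d + 1), k ≠ i ∧ k ≠ j ∧
      ∀ x ∈ S k, ∃ y ∈ convexHull ℝ ((S i : Set (EuclideanSpace ℝ (Fin d))) ∪ S j) ∩ rayToOrigin x,
        y ≠ x) :
    ∃ x : Fin (d + 1) → EuclideanSpace ℝ (Fin d), (∀ i, x i ∈ S i) ∧
      0 ∈ convexHull ℝ (Set.range x) ∧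
      ((∀ i j : Fin (d + 1), i ≠ j → Disjoint (S i) (S j)) →
        ∀ i, (Set.range x ∩ (S i : Set (EuclideanSpace ℝ (Fin d)))).ncard = 1) := by
  have hlt : ∀ i j : Fin (d + 1), i < j → ∃ k, k ≠ i ∧ k ≠ j ∧ Shields S i j k := by
    intro i j hij
    obtain ⟨k, hki, hkj, hk⟩ := hS i j hij
    refine ⟨k, hki, hkj, fun x hx => ?_⟩
    obtain ⟨y, ⟨hy, t, ht, hyt⟩, hyx⟩ := hk x hx
    -- The intersection point differs from `x` exactly so that `t > 0`, making the factor `1 - t`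
    -- less than `1`.
    have ht0 : t ≠ 0 := by
      rintro rfl
      exact hyx (by simpa using hyt)
    refine ⟨1 - t, by linarith [lt_of_le_of_ne ht (Ne.symm ht0)], ?_⟩
    have : (1 - t) • x = y := by
      rw [hyt, zero_sub, smul_neg, sub_smul, one_smul, sub_eq_add_neg]
    rwa [this]
  obtain ⟨x, hx, h0⟩ := exists_transversal_zero_mem_convexHull (S := S) (by simp) hne
    fun i j hij => by
      rcases lt_or_gt_of_ne hij with h | h
      · exact hlt i j h
      · obtain ⟨k, hkj, hki, hk⟩ := hlt j i h
        exact ⟨k, hki, hkj, hk.symm⟩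
  refine ⟨x, hx, h0, fun hdisj i => Set.ncard_eq_one.mpr ⟨x i, ?_⟩⟩
  ext v
  constructor
  · rintro ⟨⟨j, rfl⟩, hv⟩
    by_cases hji : j = i
    · rw [hji]
      rfl
    · exact absurd hv (Finset.disjoint_left.mp (hdisj j i hji) (hx j))
  · rintro rfl
    exact ⟨⟨i, rfl⟩, hx i⟩
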